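/- Let $\Omega\subset\mathbb R^2$ be open, let $b:\Omega\to\mathbb R$ be locally Lipschitz, and let $\mathbf A=(A_1,A_2)$ be a $C^1$ vector potential on $\Omega$, $\partial_1A_2-\partial_2A_1=b$. The magnetic dynamics is the Hamiltonian flow $\dot q=\partial_p\mathcal H$, $\dot p=-\partial_q\mathcal H$ of $\mathcal H(q,p)=\tfrac12\|p-\mathbf A(q)\|^2$. Let $\mathcal C$ be a connected component of $\partial\Omega$ that is a $C^2$ closed curve without self-intersections, of length $L$, with arc length parametrization $\gamma:\mathbb R/L\mathbb Z\to\mathcal C$ oriented so that the inward unit normal $N(s)$ is $\gamma'(s)$ rotated by $+\pi/2$. Let $\kappa$ be the signed curvature, $\gamma''=\kappa N$; assume that $\kappa$ is differentiable with bounded derivative, and put $K=\sup|\kappa|$, $K'=\sup|\kappa'|$. Let $\epsilon\in(0,1)$ and $0<\delta\le\epsilon/K$, and suppose that $\psi(n,s)=\gamma(s)+nN(s)$ is a bijection (hence a $C^1$ diffeomorphism) from $(0,\delta)\times\mathbb R/L\mathbb Z$ onto $\Omega_{\mathcal C}(\delta)=\{q\in\Omega:\ d(q,\mathcal C)<\delta\}$.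 Put $$B(n,s)=-b(\psi(n,s))(1-n\kappa(s)),\qquad f(n)=-\frac1L\int_n^\delta\int_0^L B(\eta,\xi)\,d\xi\,d\eta\quad(0<n\le\delta),$$ where the integrals are assumed to converge, and assume that there is $M\ge0$ with $$\Big|B(n,s)-\frac1L\int_0^LB(n,\xi)\,d\xi\Big|\le M\qquad\text{for all }(n,s)\in(0,\delta)\times\mathbb R/L\mathbb Z.$$ Let $T>0$ and let $q(t)=\psi(n(t),s(t))$, $t\in[0,T]$, be a trajectory contained in $\Omega_{\mathcal C}(\delta)$, with energy $H_0$. Put $$C(T)=\Big|\dot s(0)\,[1-\kappa(s(0))n(0)]^2-\frac1L\int_{n(0)}^\delta\int_0^LB(\eta,\xi)\,d\xi\,d\eta\Big|+\sqrt{2H_0}\,(1+\epsilon)+\Big(M\sqrt{2H_0}+\frac{2H_0K'\delta}{1-\epsilon}\Big)T$$ and assume that $\liminf_{n\to0^+}|f(n)|>C(T)$ (the lower limit may be $+\infty$). Then there exist continuous strictly decreasing functions $g:(0,\delta]\to\mathbb R$ such that $$\lim_{n\to0^+}g(n)=\liminf_{n\to0^+}|f(n)|,\qquad g\le|f|\ \text{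 on }(0,\delta],$$ and every such $g$ takes the value $C(T)$ and satisfies, for all $t\in[0,T)$, $$n(t)\ge g^{-1}(C(T)),\qquad\text{with } n(t)>g^{-1}(C(T))\ \text{ if } H_0>0.$$ -/

import Mathlib

open Set Filter Topology MeasureTheory

namespace MagneticConfinement

noncomputable section

/-- The Euclidean plane. -/
abbrev Plane : Type := EuclideanSpace ℝ (Fin 2)

/-! ### The magnetic Hamiltonian dynamics -/

/-- `A` is a `C¹` vector potential on `Ω` of the magnetic field `b dq₁ ∧ dq₂`, that is
`d(A₁ dq₁ + A₂ dq₂) = b dq₁ ∧ dq₂`, i.e. `∂₁A₂ - ∂₂A₁ = b` on `Ω`. -/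
def IsVectorPotential (Ω : Set Plane) (b : Plane → ℝ) (A : Plane → Plane) : Prop :=
  ContDiffOn ℝ 1 A Ω ∧
    ∀ q ∈ Ω, fderiv ℝ A q !₂[1, 0] 1 - fderiv ℝ A q !₂[0, 1] 0 = b q

/-- The magnetic Hamiltonian `‖p - A(q)‖² / 2`. -/
def hamiltonian (A : Plane → Plane) (q p : Plane) : ℝ :=
  ‖p - A q‖ ^ 2 / 2

/-- `(q, p)` solves Hamilton's equations `q' = ∂_p H`, `p' = -∂_q H` on the time interval `[0, T]`
(one-sided derivatives at the end points). -/
def IsTrajectory (A : Plane → Plane) (T : ℝ) (q p : ℝ → Plane) : Prop :=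
  ∀ t ∈ Icc 0 T,
    HasDerivWithinAt q (gradient (fun y => hamiltonian A (q t) y) (p t)) (Icc 0 T) t ∧
    HasDerivWithinAt p (-gradient (fun x => hamiltonian A x (p t)) (q t)) (Icc 0 T) t

/-! ### Boundary curves and tubular coordinates -/

/-- `γ` is an `L`-periodic `C²` arc length parametrization of the closed curve `C` without
self-intersections. -/
structure IsArcLengthParam (γ : ℝ → Plane) (L : ℝ) (C : Set Plane) : Prop where
  length_pos : 0 < L
  contDiff : ContDiff ℝ 2 γ
  periodic : Function.Periodic γ L
  unit_speed : ∀ s, ‖deriv γ s‖ = 1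
  injOn : InjOn γ (Ico 0 L)
  range_eq : range γ = C

/-- `C` is a connected component of the boundary of `Ω`. -/
def IsBoundaryComponent (Ω C : Set Plane) : Prop :=
  ∃ x ∈ frontier Ω, C = connectedComponentIn (frontier Ω) x

/-- The unit normal to `γ`: the unit tangent rotated by `+π/2`, so that `(γ', N)` is a direct
orthonormal frame. It is the inward normal when `γ` runs with `Ω` on its left. -/
def normal (γ : ℝ → Plane) (s : ℝ) : Plane :=
  !₂[-(deriv γ s 1), deriv γ s 0]

/-- The signed curvature `κ` of an arc length parametrized curve: `γ'' = κ N`. -/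
def curvature (γ : ℝ → Plane) (s : ℝ) : ℝ :=
  inner ℝ (deriv (deriv γ) s) (normal γ s)

/-- The tubular coordinate map `ψ(n, s) = γ(s) + n N(s)`. -/
def tube (γ : ℝ → Plane) (n s : ℝ) : Plane :=
  γ s + n • normal γ s

/-- The collar of the points of `Ω` at distance less than `δ` from `C`. -/
def collar (Ω C : Set Plane) (δ : ℝ) : Set Plane :=
  {q | q ∈ Ω ∧ Metric.infDist q C < δ}

/-- `(n, s)` are coordinates on the collar of width `δ`: `ψ` is a bijection from
`(0, δ) × ℝ/Lℤ` onto the collar. (Since its values lie in `Ω`, the normal is the inward one.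
Where `|κ| n < 1` the differential of `ψ` is invertible, so such a bijection is automatically a
diffeomorphism.) -/
def IsTubular (Ω C : Set Plane) (γ : ℝ → Plane) (L δ : ℝ) : Prop :=
  BijOn (fun x : ℝ × ℝ => tube γ x.1 x.2) (Ioo 0 δ ×ˢ Ico 0 L) (collar Ω C δ)

/-- The magnetic field in tubular coordinates, `B(n, s) = -b(ψ(n, s)) (1 - n κ(s))`. -/
def tubularField (b : Plane → ℝ) (γ : ℝ → Plane) (n s : ℝ) : ℝ :=
  -b (tube γ n s) * (1 - n * curvature γ s)

/-- `f(n) = -(1/L) ∫_n^δ ∫_0^L B(η, ξ) dξ dη`. -/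
def flux (b : Plane → ℝ) (γ : ℝ → Plane) (L δ n : ℝ) : ℝ :=
  -(1 / L) * ∫ η in n..δ, ∫ ξ in (0 : ℝ)..L, tubularField b γ η ξ

/-- `liminf_{n → 0⁺} |f(n)|`, an element of `[0, +∞]`. -/
def liminfFlux (b : Plane → ℝ) (γ : ℝ → Plane) (L δ : ℝ) : EReal :=
  liminf (fun n => ((|flux b γ L δ n| : ℝ) : EReal)) (𝓝[>] 0)

/-- The constant `C(T)`, where `n₀, s₀, v₀` stand for `n(0), s(0), s'(0)`. -/
def confinementConst (b : Plane → ℝ) (γ : ℝ → Plane) (L δ ε M H₀ n₀ s₀ v₀ T : ℝ) : ℝ :=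
  |v₀ * (1 - curvature γ s₀ * n₀) ^ 2
      - (1 / L) * ∫ η in n₀..δ, ∫ ξ in (0 : ℝ)..L, tubularField b γ η ξ|
    + √(2 * H₀) * (1 + ε)
    + (M * √(2 * H₀) + 2 * H₀ * (⨆ s, |deriv (curvature γ) s|) * δ / (1 - ε)) * T

/-- `g` is a continuous strictly decreasing function on `(0, δ]` with `g ≤ |f|` and
`lim_{n → 0} g(n) = liminf_{n → 0} |f(n)|` (possibly `+∞`). -/
structure IsMinorant (b : Plane → ℝ) (γ : ℝ → Plane) (L δ : ℝ) (g : ℝ → ℝ) : Prop where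
  continuousOn : ContinuousOn g (Ioc 0 δ)
  strictAntiOn : StrictAntiOn g (Ioc 0 δ)
  le_abs : ∀ n ∈ Ioc 0 δ, g n ≤ |flux b γ L δ n|
  tendsto : Tendsto (fun n => (g n : EReal)) (𝓝[>] 0) (𝓝 (liminfFlux b γ L δ))

end

end MagneticConfinement

open MagneticConfinement

/-- The infimum of `F` over `(0, n]`. -/
noncomputable def runningInf (F : ℝ → ℝ) (n : ℝ) : ℝ := sInf (F '' Ioc 0 n)

section RunningInf

variable {F : ℝ → ℝ}

theorem bddBelow_image_of_nonneg (hF : ∀ x, 0 ≤ F x) (s : Set ℝ) : BddBelow (F '' s) :=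
  ⟨0, by rintro _ ⟨x, -, rfl⟩; exact hF x⟩

theorem runningInf_le (hF : ∀ x, 0 ≤ F x) {x n : ℝ} (hx : x ∈ Ioc 0 n) : runningInf F n ≤ F x :=
  csInf_le (bddBelow_image_of_nonneg hF _) (mem_image_of_mem _ hx)

theorem le_runningInf {a n : ℝ} (hn : 0 < n) (h : ∀ x ∈ Ioc 0 n, a ≤ F x) :
    a ≤ runningInf F n :=
  le_csInf ⟨F n, n, ⟨hn, le_rfl⟩, rfl⟩ (by rintro _ ⟨x, hx, rfl⟩; exact h x hx)

theorem antitoneOn_runningInf (hF : ∀ x, 0 ≤ F x) : AntitoneOn (runningInf F) (Ioi 0) :=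
  fun _ hx _ _ hxy => le_runningInf hx fun _ hz => runningInf_le hF ⟨hz.1, hz.2.trans hxy⟩

theorem tendsto_runningInf (hF : ∀ x, 0 ≤ F x) :
    Tendsto (fun n => (runningInf F n : EReal)) (𝓝[>] 0)
      (𝓝 (liminf (fun n => (F n : EReal)) (𝓝[>] 0))) := by
  refine tendsto_order.2 ⟨fun a ha => ?_, fun a ha => ?_⟩
  · obtain ⟨a', haa', ha'⟩ := exists_between ha
    have h := eventually_lt_of_lt_liminf ha'
    obtain ⟨r, hr, hr'⟩ := (mem_nhdsGT_iff_exists_Ioc_subset).1 h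
    filter_upwards [Ioc_mem_nhdsGT hr] with n hn
    refine haa'.trans_le ?_
    have hlt : ∀ x ∈ Ioc 0 n, a' < (F x : EReal) := fun x hx => hr' ⟨hx.1, hx.2.trans hn.2⟩
    induction a' using EReal.rec with
    | bot => exact bot_le
    | top => exact absurd (hlt n ⟨hn.1, le_rfl⟩) not_top_lt
    | coe c =>
      exact EReal.coe_le_coe_iff.2
        (le_runningInf hn.1 fun x hx => EReal.coe_le_coe_iff.1 (hlt x hx).le)
  · have h := frequently_lt_of_liminf_lt (by isBoundedDefault) ha
    filter_upwards [self_mem_nhdsWithin] with n hn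
    obtain ⟨x, hx, hx'⟩ := (h.and_eventually (Ioc_mem_nhdsGT hn)).exists
    exact (EReal.coe_le_coe_iff.2 (runningInf_le hF hx')).trans_lt hx

end RunningInf

/-- The average of `h` over `[n, 2n]`. -/
noncomputable def dyadicMean (h : ℝ → ℝ) (n : ℝ) : ℝ := ∫ u in (1 : ℝ)..2, h (n * u)

section DyadicMean

variable {h : ℝ → ℝ}

theorem AntitoneOn.intervalIntegrable_of_pos (hh : AntitoneOn h (Ioi 0)) {a b : ℝ} (ha : 0 < a)
    (hb : 0 < b) : IntervalIntegrable h volume a b :=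
  AntitoneOn.intervalIntegrable (hh.mono fun _ hx => (lt_min ha hb).trans_le hx.1)

theorem AntitoneOn.intervalIntegrable_dilation (hh : AntitoneOn h (Ioi 0)) {n : ℝ} (hn : 0 < n) :
    IntervalIntegrable (fun u => h (n * u)) volume 1 2 := by
  refine AntitoneOn.intervalIntegrable fun x hx y hy hxy => ?_
  rw [uIcc_of_le one_le_two] at hx hy
  exact hh (mul_pos hn (one_pos.trans_le hx.1)) (mul_pos hn (one_pos.trans_le hy.1))
    (mul_le_mul_of_nonneg_left hxy hn.le)

theorem dyadicMean_le (hh : AntitoneOn h (Ioi 0)) {n : ℝ} (hn : 0 < n) : dyadicMean h n ≤ h n := by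
  have := intervalIntegral.integral_mono_on (μ := volume) one_le_two
    (hh.intervalIntegrable_dilation hn) (intervalIntegrable_const (c := h n)) fun u hu =>
      hh hn (mul_pos hn (one_pos.trans_le hu.1)) (le_mul_of_one_le_right hn.le hu.1)
  norm_num at this
  exact this

theorem le_dyadicMean (hh : AntitoneOn h (Ioi 0)) {n : ℝ} (hn : 0 < n) :
    h (n * 2) ≤ dyadicMean h n := by
  have := intervalIntegral.integral_mono_on (μ := volume) one_le_two
    (intervalIntegrable_const (c := h (n * 2))) (hh.intervalIntegrable_dilation hn) fun u hu =>
      hh (mul_pos hn (one_pos.trans_le hu.1)) (mul_pos hn two_pos)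
        (mul_le_mul_of_nonneg_left hu.2 hn.le)
  norm_num at this
  exact this

theorem antitoneOn_dyadicMean (hh : AntitoneOn h (Ioi 0)) : AntitoneOn (dyadicMean h) (Ioi 0) :=
  fun _ hx _ hy hxy => intervalIntegral.integral_mono_on one_le_two
    (hh.intervalIntegrable_dilation hy) (hh.intervalIntegrable_dilation hx) fun _ hu =>
      hh (mul_pos hx (one_pos.trans_le hu.1)) (mul_pos hy (one_pos.trans_le hu.1))
        (mul_le_mul_of_nonneg_right hxy (zero_le_one.trans hu.1))

theorem continuousOn_integral_of_antitoneOn (hh : AntitoneOn h (Ioi 0)) :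
    ContinuousOn (fun x => ∫ u in (1 : ℝ)..x, h u) (Ioi 0) := by
  intro x hx
  have hx : (0 : ℝ) < x := hx
  have hint := hh.intervalIntegrable_of_pos (a := min 1 (x / 2)) (b := max 1 (2 * x))
    (lt_min one_pos (by linarith)) (lt_max_of_lt_left one_pos)
  have hle : min 1 (x / 2) ≤ max 1 (2 * x) := (min_le_left _ _).trans (le_max_left _ _)
  have hc : ContinuousOn (fun x => ∫ u in (1 : ℝ)..x, h u)
      (uIcc (min 1 (x / 2)) (max 1 (2 * x))) := by
    refine intervalIntegral.continuousOn_primitive_interval' hint ?_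
    rw [uIcc_of_le hle]
    exact ⟨min_le_left _ _, le_max_left _ _⟩
  rw [uIcc_of_le hle] at hc
  refine (hc.continuousAt (Icc_mem_nhds ?_ ?_)).continuousWithinAt
  · exact (min_le_right _ _).trans_lt (by linarith)
  · exact lt_max_of_lt_right (by linarith)

theorem continuousOn_dyadicMean (hh : AntitoneOn h (Ioi 0)) :
    ContinuousOn (dyadicMean h) (Ioi 0) := by
  have hp := continuousOn_integral_of_antitoneOn hh
  have hmaps : MapsTo (fun n : ℝ => n * 2) (Ioi 0) (Ioi 0) := fun x (hx : 0 < x) =>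
    show 0 < x * 2 by positivity
  have hc : ContinuousOn
      (fun n : ℝ => n⁻¹ * ((∫ u in (1 : ℝ)..n * 2, h u) - ∫ u in (1 : ℝ)..n, h u)) (Ioi 0) :=
    (continuousOn_id.inv₀ fun _ hx => ne_of_gt hx).mul
      ((hp.comp (continuous_mul_const 2).continuousOn hmaps).sub hp)
  refine hc.congr fun n hn => ?_
  have hn : (0 : ℝ) < n := hn
  rw [dyadicMean, intervalIntegral.integral_comp_mul_left h hn.ne', mul_one, smul_eq_mul,
    ← intervalIntegral.integral_interval_sub_left]
  · exact hh.intervalIntegrable_of_pos one_pos (by positivity)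
  · exact hh.intervalIntegrable_of_pos one_pos hn

theorem tendsto_dyadicMean (hh : AntitoneOn h (Ioi 0)) {l : EReal}
    (hl : Tendsto (fun n => (h n : EReal)) (𝓝[>] 0) (𝓝 l)) :
    Tendsto (fun n => (dyadicMean h n : EReal)) (𝓝[>] 0) (𝓝 l) := by
  have h2 : Tendsto (fun n : ℝ => n * 2) (𝓝[>] 0) (𝓝[>] 0) := by
    refine tendsto_nhdsWithin_iff.2 ⟨?_, ?_⟩
    · have : Tendsto (fun n : ℝ => n * 2) (𝓝 0) (𝓝 (0 * 2)) := tendsto_id.mul_const 2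
      rw [zero_mul] at this
      exact this.mono_left nhdsWithin_le_nhds
    · filter_upwards [self_mem_nhdsWithin] with n (hn : 0 < n)
      exact show 0 < n * 2 by positivity
  refine tendsto_of_tendsto_of_tendsto_of_le_of_le' (hl.comp h2) hl ?_ ?_
  · filter_upwards [self_mem_nhdsWithin] with n hn
    exact EReal.coe_le_coe_iff.2 (le_dyadicMean hh hn)
  · filter_upwards [self_mem_nhdsWithin] with n hn
    exact EReal.coe_le_coe_iff.2 (dyadicMean_le hh hn)

end DyadicMean

theorem tendsto_coe_sub_id {h : ℝ → ℝ} {l : EReal}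
    (hl : Tendsto (fun n => (h n : EReal)) (𝓝[>] 0) (𝓝 l)) :
    Tendsto (fun n => ((h n - n : ℝ) : EReal)) (𝓝[>] 0) (𝓝 l) := by
  have h0 : Tendsto (fun n : ℝ => ((-n : ℝ) : EReal)) (𝓝[>] 0) (𝓝 0) := by
    have : Tendsto (fun n : ℝ => ((-n : ℝ) : EReal)) (𝓝 0) (𝓝 ((-0 : ℝ) : EReal)) :=
      (continuous_coe_real_ereal.comp continuous_neg).tendsto 0
    rw [neg_zero] at this
    exact this.mono_left nhdsWithin_le_nhds
  have := (EReal.continuousAt_add (p := (l, 0)) (by simp) (by simp)).tendsto.comp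
    (hl.prodMk_nhds h0)
  simpa [Function.comp_def, sub_eq_add_neg] using this

theorem exists_isMinorant (b : Plane → ℝ) (γ : ℝ → Plane) (L δ : ℝ) :
    ∃ g : ℝ → ℝ, IsMinorant b γ L δ g := by
  have hF : ∀ n, 0 ≤ |flux b γ L δ n| := fun n => abs_nonneg _
  have hh := antitoneOn_runningInf hF
  have hpos : Ioc 0 δ ⊆ Ioi 0 := fun x hx => hx.1
  refine ⟨fun n => dyadicMean (runningInf fun n => |flux b γ L δ n|) n - n, ?_, ?_, ?_, ?_⟩
  · exact ((continuousOn_dyadicMean hh).mono hpos).sub continuousOn_id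
  · intro x hx y hy hxy
    have := antitoneOn_dyadicMean hh hx.1 hy.1 hxy.le
    linarith
  · intro n hn
    have h1 := dyadicMean_le hh hn.1
    have h2 : runningInf (fun n => |flux b γ L δ n|) n ≤ |flux b γ L δ n| :=
      runningInf_le hF ⟨hn.1, le_rfl⟩
    linarith [hn.1]
  · exact tendsto_coe_sub_id (tendsto_dyadicMean hh (tendsto_runningInf hF))

theorem MagneticConfinement.IsMinorant.exists_eq {b : Plane → ℝ} {γ : ℝ → Plane} {L δ : ℝ}
    {g : ℝ → ℝ} (hg : IsMinorant b γ L δ g) (hδ : 0 < δ) {c : ℝ} (hc : 0 ≤ c)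
    (hlim : (c : EReal) < liminfFlux b γ L δ) : ∃ m ∈ Ioc 0 δ, g m = c := by
  obtain ⟨x, hx, hx'⟩ :=
    ((hg.tendsto.eventually (lt_mem_nhds hlim)).and (Ioc_mem_nhdsGT hδ)).exists
  have hgδ : g δ ≤ c := by
    have := hg.le_abs δ ⟨hδ, le_rfl⟩
    simp only [flux, intervalIntegral.integral_same, mul_zero, abs_zero] at this
    exact this.trans hc
  obtain ⟨m, hm, hm'⟩ := intermediate_value_Icc' hx'.2
    (hg.continuousOn.mono fun y hy => ⟨hx'.1.trans_le hy.1, hy.2⟩)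
    ⟨hgδ, (EReal.coe_lt_coe_iff.1 hx).le⟩
  exact ⟨m, ⟨hx'.1.trans_le hm.1, hm.2⟩, hm'⟩

theorem HasDerivWithinAt.plane_apply {f : ℝ → Plane} {f' : Plane} {S : Set ℝ} {x : ℝ}
    (h : HasDerivWithinAt f f' S x) (i : Fin 2) : HasDerivWithinAt (fun t => f t i) (f' i) S x :=
  (EuclideanSpace.proj i : Plane →L[ℝ] ℝ).hasFDerivAt.comp_hasDerivWithinAt x h

theorem HasDerivAt.plane_apply {f : ℝ → Plane} {f' : Plane} {x : ℝ}
    (h : HasDerivAt f f' x) (i : Fin 2) : HasDerivAt (fun t => f t i) (f' i) x :=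
  (EuclideanSpace.proj i : Plane →L[ℝ] ℝ).hasFDerivAt.comp_hasDerivAt x h

theorem plane_norm_sq (x : Plane) : ‖x‖ ^ 2 = x 0 ^ 2 + x 1 ^ 2 := by
  simp [EuclideanSpace.norm_sq_eq, Fin.sum_univ_two]

theorem plane_inner (x y : Plane) : inner ℝ x y = x 0 * y 0 + x 1 * y 1 := by
  simp [PiLp.inner_apply, Fin.sum_univ_two, mul_comm]

theorem tube_apply_zero (γ : ℝ → Plane) (n s : ℝ) : tube γ n s 0 = γ s 0 - n * deriv γ s 1 := by
  simp [tube, normal, sub_eq_add_neg]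

theorem tube_apply_one (γ : ℝ → Plane) (n s : ℝ) : tube γ n s 1 = γ s 1 + n * deriv γ s 0 := by
  simp [tube, normal]

theorem curvature_eq (γ : ℝ → Plane) (s : ℝ) :
    curvature γ s = deriv (deriv γ) s 1 * deriv γ s 0 - deriv (deriv γ) s 0 * deriv γ s 1 := by
  simp only [curvature, plane_inner, normal]
  simp
  ring

theorem deriv_add_period {γ : ℝ → Plane} {L : ℝ} (h : Function.Periodic γ L) :
    Function.Periodic (deriv γ) L := fun s => by
  have : (fun x => γ (x + L)) = γ := funext h
  rw [← deriv_comp_add_const, this]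

/-- The derivative of the coordinates of `tube γ` at a point where the unit tangent is `(c, d)` and
`r = 1 - n κ`. -/
noncomputable def tubeDerivEquiv (c d r : ℝ) (hcd : c ^ 2 + d ^ 2 = 1) (hr : r ≠ 0) :
    (ℝ × ℝ) ≃L[ℝ] ℝ × ℝ :=
  LinearEquiv.toContinuousLinearEquiv
    { toFun := fun x => (-(d * x.1) + r * c * x.2, c * x.1 + r * d * x.2)
      invFun := fun y => (-(d * y.1) + c * y.2, (c * y.1 + d * y.2) / r)
      map_add' := fun x y => by ext <;> simp <;> ring
      map_smul' := fun a x => by ext <;> simp <;> ring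
      left_inv := fun x => by
        ext
        · linear_combination x.1 * hcd
        · simp only
          field_simp
          linear_combination r * x.2 * hcd
      right_inv := fun y => by
        ext
        · simp only
          field_simp
          linear_combination y.1 * hcd
        · simp only
          field_simp
          linear_combination y.2 * hcd }

theorem tubeDerivEquiv_apply {c d r : ℝ} (hcd : c ^ 2 + d ^ 2 = 1) (hr : r ≠ 0) (x : ℝ × ℝ) :
    tubeDerivEquiv c d r hcd hr x = (-(d * x.1) + r * c * x.2, c * x.1 + r * d * x.2) := rfl

namespace MagneticConfinement.IsArcLengthParam

variable {γ : ℝ → Plane} {L : ℝ} {C : Set Plane}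

theorem hasDerivAt (hγ : IsArcLengthParam γ L C) (s : ℝ) : HasDerivAt γ (deriv γ s) s :=
  (hγ.contDiff.differentiable (by norm_num) s).hasDerivAt

theorem contDiff_deriv (hγ : IsArcLengthParam γ L C) : ContDiff ℝ 1 (deriv γ) :=
  (contDiff_succ_iff_deriv.1 (show ContDiff ℝ (1 + 1) γ by
    rw [one_add_one_eq_two]; exact hγ.contDiff)).2.2

theorem hasDerivAt_deriv (hγ : IsArcLengthParam γ L C) (s : ℝ) :
    HasDerivAt (deriv γ) (deriv (deriv γ) s) s :=
  (hγ.contDiff_deriv.differentiable (by norm_num) s).hasDerivAt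

theorem deriv_sq (hγ : IsArcLengthParam γ L C) (s : ℝ) :
    deriv γ s 0 ^ 2 + deriv γ s 1 ^ 2 = 1 := by
  rw [← plane_norm_sq, hγ.unit_speed, one_pow]

theorem deriv_orthogonal (hγ : IsArcLengthParam γ L C) (s : ℝ) :
    deriv γ s 0 * deriv (deriv γ) s 0 + deriv γ s 1 * deriv (deriv γ) s 1 = 0 := by
  have h := (((hγ.hasDerivAt_deriv s).plane_apply 0).pow 2).add
    (((hγ.hasDerivAt_deriv s).plane_apply 1).pow 2)
  have hc : ((fun t => deriv γ t 0) ^ 2 + (fun t => deriv γ t 1) ^ 2) = fun _ => (1 : ℝ) :=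
    funext fun t => hγ.deriv_sq t
  rw [hc] at h
  have := h.unique (hasDerivAt_const s (1 : ℝ))
  simp at this
  linarith

theorem hasDerivAt_deriv_zero (hγ : IsArcLengthParam γ L C) (s : ℝ) :
    HasDerivAt (fun t => deriv γ t 0) (-(curvature γ s * deriv γ s 1)) s := by
  convert (hγ.hasDerivAt_deriv s).plane_apply 0 using 1
  rw [curvature_eq]
  linear_combination deriv (deriv γ) s 0 * hγ.deriv_sq s - deriv γ s 0 * hγ.deriv_orthogonal s

theorem hasDerivAt_deriv_one (hγ : IsArcLengthParam γ L C) (s : ℝ) :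
    HasDerivAt (fun t => deriv γ t 1) (curvature γ s * deriv γ s 0) s := by
  convert (hγ.hasDerivAt_deriv s).plane_apply 1 using 1
  rw [curvature_eq]
  linear_combination deriv (deriv γ) s 1 * hγ.deriv_sq s - deriv γ s 1 * hγ.deriv_orthogonal s

theorem contDiff_apply (hγ : IsArcLengthParam γ L C) (i : Fin 2) :
    ContDiff ℝ 1 fun s => γ s i :=
  (EuclideanSpace.proj i : Plane →L[ℝ] ℝ).contDiff.comp (hγ.contDiff.of_le (by norm_num))

theorem contDiff_deriv_apply (hγ : IsArcLengthParam γ L C) (i : Fin 2) :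
    ContDiff ℝ 1 fun s => deriv γ s i :=
  (EuclideanSpace.proj i : Plane →L[ℝ] ℝ).contDiff.comp hγ.contDiff_deriv

theorem continuous_tube (hγ : IsArcLengthParam γ L C) :
    Continuous fun x : ℝ × ℝ => tube γ x.1 x.2 := by
  have h0 := (hγ.contDiff_deriv_apply 0).continuous
  have h1 := (hγ.contDiff_deriv_apply 1).continuous
  have hN : Continuous (normal γ) := by
    refine (PiLp.continuous_toLp 2 _).comp (continuous_pi fun i => ?_)
    fin_cases i
    · exact h1.neg
    · exact h0
  exact (hγ.contDiff.continuous.comp continuous_snd).add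
    (continuous_fst.smul (hN.comp continuous_snd))

theorem periodic_tube (hγ : IsArcLengthParam γ L C) (n : ℝ) : Function.Periodic (tube γ n) L :=
  fun s => by simp only [tube, normal, hγ.periodic s, deriv_add_period hγ.periodic s]

theorem periodic_curvature (hγ : IsArcLengthParam γ L C) :
    Function.Periodic (curvature γ) L := fun s => by
  simp only [curvature_eq, deriv_add_period hγ.periodic s,
    deriv_add_period (deriv_add_period hγ.periodic) s]

theorem continuous_curvature (hγ : IsArcLengthParam γ L C) : Continuous (curvature γ) := by
  have h0 := (hγ.contDiff_deriv_apply 0).continuous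
  have h1 := (hγ.contDiff_deriv_apply 1).continuous
  have h := hγ.contDiff_deriv.continuous_deriv le_rfl
  have h2 : ∀ i : Fin 2, Continuous fun s => deriv (deriv γ) s i := fun i =>
    (EuclideanSpace.proj i : Plane →L[ℝ] ℝ).continuous.comp h
  rw [funext (curvature_eq γ)]
  exact ((h2 1).mul h0).sub ((h2 0).mul h1)

theorem abs_curvature_le (hγ : IsArcLengthParam γ L C) (s : ℝ) :
    |curvature γ s| ≤ ⨆ s, |curvature γ s| := by
  refine le_ciSup (f := fun s => |curvature γ s|) ?_ s
  have hp : Function.Periodic (fun s => |curvature γ s|) L := fun s => by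
    simp only [hγ.periodic_curvature s]
  exact (hp.compact_of_continuous hγ.length_pos.ne' hγ.continuous_curvature.abs).bddAbove

theorem abs_mul_curvature_lt (hγ : IsArcLengthParam γ L C) {ε δ n : ℝ} (hδ : 0 < δ)
    (hδε : δ ≤ ε / ⨆ s, |curvature γ s|) (hn : n ∈ Ioo 0 δ) (s : ℝ) :
    |n * curvature γ s| < ε := by
  have hK0 : 0 ≤ ⨆ s, |curvature γ s| := (abs_nonneg _).trans (hγ.abs_curvature_le s)
  have hK : 0 < ⨆ s, |curvature γ s| := by
    refine hK0.lt_of_ne fun h => ?_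
    rw [← h, div_zero] at hδε
    exact hδ.not_ge hδε
  rw [abs_mul, abs_of_pos hn.1]
  calc n * |curvature γ s| ≤ n * ⨆ s, |curvature γ s| :=
        mul_le_mul_of_nonneg_left (hγ.abs_curvature_le s) hn.1.le
    _ < δ * ⨆ s, |curvature γ s| := mul_lt_mul_of_pos_right hn.2 hK
    _ ≤ ε := (le_div_iff₀ hK).1 hδε

theorem tube_mem (hγ : IsArcLengthParam γ L C) {Ω : Set Plane} {δ : ℝ}
    (htub : IsTubular Ω C γ L δ) {n : ℝ} (hn : n ∈ Ioo 0 δ) (s : ℝ) : tube γ n s ∈ Ω := by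
  obtain ⟨s', hs', h⟩ := (hγ.periodic_tube n).exists_mem_Ico₀ hγ.length_pos s
  rw [h]
  exact (htub.mapsTo (show (n, s') ∈ Ioo 0 δ ×ˢ Ico 0 L from ⟨hn, hs'⟩)).1

theorem continuousOn_tubularField_mean (hγ : IsArcLengthParam γ L C) {Ω : Set Plane} {δ : ℝ}
    (htub : IsTubular Ω C γ L δ) {b : Plane → ℝ} (hb : ContinuousOn b Ω) :
    ContinuousOn (fun η => ∫ ξ in (0 : ℝ)..L, tubularField b γ η ξ) (Ioo 0 δ) := by
  rw [continuousOn_iff_continuous_domRestrict]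
  refine intervalIntegral.continuous_parametric_intervalIntegral_of_continuous'
    (f := fun (η : Ioo 0 δ) ξ => tubularField b γ η ξ) ?_ 0 L
  have hκ := hγ.continuous_curvature
  have h1 : Continuous fun x : Ioo 0 δ × ℝ => b (tube γ x.1 x.2) :=
    hb.comp_continuous
      (hγ.continuous_tube.comp (by fun_prop : Continuous fun x : Ioo 0 δ × ℝ => ((x.1 : ℝ), x.2)))
      fun x => hγ.tube_mem htub x.1.2 x.2
  have h2 : Continuous fun x : Ioo 0 δ × ℝ => 1 - (x.1 : ℝ) * curvature γ x.2 := by fun_prop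
  exact h1.neg.mul h2

theorem hasDerivAt_flux (hγ : IsArcLengthParam γ L C) {Ω : Set Plane} {δ : ℝ}
    (htub : IsTubular Ω C γ L δ) {b : Plane → ℝ} (hb : ContinuousOn b Ω) {n : ℝ}
    (hn : n ∈ Ioo 0 δ)
    (hint : IntervalIntegrable (fun η => ∫ ξ in (0 : ℝ)..L, tubularField b γ η ξ) volume n δ) :
    HasDerivAt (flux b γ L δ) (1 / L * ∫ ξ in (0 : ℝ)..L, tubularField b γ n ξ) n := by
  have hc := hγ.continuousOn_tubularField_mean htub hb
  have h := (intervalIntegral.integral_hasDerivAt_left hint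
    (hc.stronglyMeasurableAtFilter isOpen_Ioo n hn)
    (hc.continuousAt (isOpen_Ioo.mem_nhds hn))).const_mul (-(1 / L))
  rw [neg_mul_neg] at h
  exact h

theorem hasStrictFDerivAt_tube (hγ : IsArcLengthParam γ L C) {n s : ℝ}
    (hr : 1 - n * curvature γ s ≠ 0) :
    HasStrictFDerivAt (fun x : ℝ × ℝ => (tube γ x.1 x.2 0, tube γ x.1 x.2 1))
      (tubeDerivEquiv (deriv γ s 0) (deriv γ s 1) _ (hγ.deriv_sq s) hr : ℝ × ℝ →L[ℝ] ℝ × ℝ)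
      (n, s) := by
  have hcd : ContDiff ℝ 1 fun x : ℝ × ℝ => (tube γ x.1 x.2 0, tube γ x.1 x.2 1) := by
    simp only [tube_apply_zero, tube_apply_one]
    exact (((hγ.contDiff_apply 0).comp contDiff_snd).sub
      (contDiff_fst.mul ((hγ.contDiff_deriv_apply 1).comp contDiff_snd))).prodMk
      (((hγ.contDiff_apply 1).comp contDiff_snd).add
      (contDiff_fst.mul ((hγ.contDiff_deriv_apply 0).comp contDiff_snd)))
  refine hcd.contDiffAt.hasStrictFDerivAt' ?_ one_ne_zero
  simp only [tube_apply_zero, tube_apply_one]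
  have hfst : HasFDerivAt (fun x : ℝ × ℝ => x.1) (ContinuousLinearMap.fst ℝ ℝ ℝ) (n, s) :=
    hasFDerivAt_fst
  have hsnd : HasFDerivAt (fun x : ℝ × ℝ => x.2) (ContinuousLinearMap.snd ℝ ℝ ℝ) (n, s) :=
    hasFDerivAt_snd
  have hx := (((hγ.hasDerivAt s).plane_apply 0).comp_hasFDerivAt (n, s) hsnd).sub
    (hfst.mul ((hγ.hasDerivAt_deriv_one s).comp_hasFDerivAt (n, s) hsnd))
  have hy := (((hγ.hasDerivAt s).plane_apply 1).comp_hasFDerivAt (n, s) hsnd).add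
    (hfst.mul ((hγ.hasDerivAt_deriv_zero s).comp_hasFDerivAt (n, s) hsnd))
  refine (hx.prodMk hy).congr_fderiv ?_
  ext <;> simp [tubeDerivEquiv_apply] <;> ring

theorem normal_coordinate (hγ : IsArcLengthParam γ L C) (n s : ℝ) :
    (tube γ n s 1 - γ s 1) * deriv γ s 0 - (tube γ n s 0 - γ s 0) * deriv γ s 1 = n := by
  rw [tube_apply_zero, tube_apply_one]
  linear_combination n * hγ.deriv_sq s

/-- Tubular coordinates of a differentiable curve are differentiable as soon as the arc length
coordinate is continuous. -/
theorem hasDerivWithinAt_coordinates (hγ : IsArcLengthParam γ L C) {I : Set ℝ} {q : ℝ → Plane}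
    {n s : ℝ → ℝ} (hs : ContinuousOn s I) (hns : ∀ t ∈ I, q t = tube γ (n t) (s t))
    {t : ℝ} (ht : t ∈ I) {v : Plane} (hq : HasDerivWithinAt q v I t) (hqc : ContinuousOn q I)
    (hr : 1 - n t * curvature γ (s t) ≠ 0) :
    HasDerivWithinAt n (v 1 * deriv γ (s t) 0 - v 0 * deriv γ (s t) 1) I t ∧
    HasDerivWithinAt s ((v 0 * deriv γ (s t) 0 + v 1 * deriv γ (s t) 1) /
      (1 - n t * curvature γ (s t))) I t := by
  have hqi : ∀ i : Fin 2, ContinuousOn (fun t => q t i) I := fun i =>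
    (EuclideanSpace.proj i : Plane →L[ℝ] ℝ).continuous.comp_continuousOn hqc
  have hn : ContinuousOn n I := by
    have hc : ContinuousOn (fun t => (q t 1 - γ (s t) 1) * deriv γ (s t) 0 -
        (q t 0 - γ (s t) 0) * deriv γ (s t) 1) I :=
      (((hqi 1).sub ((hγ.contDiff_apply 1).continuous.comp_continuousOn hs)).mul
        ((hγ.contDiff_deriv_apply 0).continuous.comp_continuousOn hs)).sub
      (((hqi 0).sub ((hγ.contDiff_apply 0).continuous.comp_continuousOn hs)).mul
        ((hγ.contDiff_deriv_apply 1).continuous.comp_continuousOn hs))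
    refine hc.congr fun x hx => ?_
    simp only [hns x hx]
    exact (hγ.normal_coordinate _ _).symm
  have hψ := hγ.hasStrictFDerivAt_tube hr
  have hev : ∀ᶠ x in 𝓝[I] t, hψ.localInverse _ _ _ (q x 0, q x 1) = (n x, s x) := by
    have h1 : Tendsto (fun x => (n x, s x)) (𝓝[I] t) (𝓝 (n t, s t)) :=
      (hn t ht).prodMk (hs t ht)
    filter_upwards [h1.eventually hψ.eventually_left_inverse, self_mem_nhdsWithin] with x hx hxI
    rw [hns x hxI]
    exact hx
  have hqt : (tube γ (n t) (s t) 0, tube γ (n t) (s t) 1) = (q t 0, q t 1) := by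
    rw [hns t ht]
  have hinv := hψ.to_localInverse.hasFDerivAt
  simp only [hqt] at hinv
  have hd := hinv.comp_hasDerivWithinAt t ((hq.plane_apply 0).prodMk (hq.plane_apply 1))
  have hd' := hd.congr_of_eventuallyEq (f₁ := fun x => (n x, s x))
    (hev.mono fun x hx => hx.symm) (hev.self_of_nhdsWithin ht).symm
  constructor
  · refine ((ContinuousLinearMap.fst ℝ ℝ ℝ).hasFDerivAt.comp_hasDerivWithinAt t hd').congr_deriv ?_
    change -(deriv γ (s t) 1 * v 0) + deriv γ (s t) 0 * v 1 = _
    ring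
  · refine ((ContinuousLinearMap.snd ℝ ℝ ℝ).hasFDerivAt.comp_hasDerivWithinAt t hd').congr_deriv ?_
    change (deriv γ (s t) 0 * v 0 + deriv γ (s t) 1 * v 1) / (1 - n t * curvature γ (s t)) = _
    ring

end MagneticConfinement.IsArcLengthParam

theorem inner_gradient_half_norm_sq {F : Plane → Plane} {F' : Plane →L[ℝ] Plane} {x : Plane}
    (hF : HasFDerivAt F F' x) (w : Plane) :
    inner ℝ (gradient (fun y => ‖F y‖ ^ 2 / 2) x) w = inner ℝ (F x) (F' w) := by
  have h : HasFDerivAt (fun y => ‖F y‖ ^ 2 / 2) ((innerSL ℝ (F x)).comp F') x := by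
    refine (hF.norm_sq.mul_const (2 : ℝ)⁻¹).congr_fderiv ?_
    ext w
    simp
  rw [inner_gradient_left, h.fderiv]
  simp

theorem gradient_hamiltonian_momentum (A : Plane → Plane) (q p : Plane) :
    gradient (fun y => hamiltonian A q y) p = p - A q := by
  refine ext_inner_right ℝ fun w => ?_
  exact inner_gradient_half_norm_sq ((hasFDerivAt_id p).sub_const (A q)) w

theorem inner_gradient_hamiltonian_position {A : Plane → Plane} {q : Plane}
    (hA : DifferentiableAt ℝ A q) (p w : Plane) :
    inner ℝ (gradient (fun x => hamiltonian A x p) q) w = -inner ℝ (p - A q) (fderiv ℝ A q w) := by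
  have h : HasFDerivAt (fun x => p - A x) (-fderiv ℝ A q) q := hA.hasFDerivAt.const_sub p
  refine (inner_gradient_half_norm_sq h w).trans ?_
  simp

theorem plane_eq_sum (v : Plane) : v = v 0 • !₂[(1 : ℝ), 0] + v 1 • !₂[(0 : ℝ), 1] := by
  ext i
  fin_cases i <;> simp

/-- Newton's equation with the Lorentz force. -/
theorem hasDerivWithinAt_velocity {Ω : Set Plane} (hΩ : IsOpen Ω) {b : Plane → ℝ}
    {A : Plane → Plane} (hA : IsVectorPotential Ω b A) {T : ℝ} {q p : ℝ → Plane}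
    (hqp : IsTrajectory A T q p) {t : ℝ} (ht : t ∈ Icc 0 T) (hq : q t ∈ Ω) :
    HasDerivWithinAt q (p t - A (q t)) (Icc 0 T) t ∧
    HasDerivWithinAt (fun t => (p t - A (q t)) 0) (b (q t) * (p t - A (q t)) 1) (Icc 0 T) t ∧
    HasDerivWithinAt (fun t => (p t - A (q t)) 1) (-(b (q t) * (p t - A (q t)) 0)) (Icc 0 T) t := by
  obtain ⟨hq', hp'⟩ := hqp t ht
  rw [gradient_hamiltonian_momentum] at hq'
  have hdA : DifferentiableAt ℝ A (q t) :=
    (hA.1.contDiffAt (hΩ.mem_nhds hq)).differentiableAt one_ne_zero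
  have hv := hp'.sub (hdA.hasFDerivAt.comp_hasDerivWithinAt t hq')
  set v := p t - A (q t) with hvdef
  have hb := hA.2 (q t) hq
  have hDv : ∀ i, fderiv ℝ A (q t) v i =
      v 0 * fderiv ℝ A (q t) !₂[1, 0] i + v 1 * fderiv ℝ A (q t) !₂[0, 1] i := fun i => by
    conv_lhs => rw [plane_eq_sum v, map_add, map_smul, map_smul]
    simp
  have h0 := inner_gradient_hamiltonian_position hdA (p t) !₂[1, 0]
  have h1 := inner_gradient_hamiltonian_position hdA (p t) !₂[0, 1]
  rw [plane_inner, plane_inner, ← hvdef] at h0 h1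
  simp only [Matrix.cons_val_zero, Matrix.cons_val_one, mul_one, mul_zero,
    add_zero, zero_add] at h0 h1
  refine ⟨hq', (hv.plane_apply 0).congr_deriv ?_, (hv.plane_apply 1).congr_deriv ?_⟩
  · rw [PiLp.sub_apply, PiLp.neg_apply, hDv, h0]
    linear_combination v 1 * hb
  · rw [PiLp.sub_apply, PiLp.neg_apply, hDv, h1]
    linear_combination -v 0 * hb

theorem energy_conservation {Ω : Set Plane} (hΩ : IsOpen Ω) {b : Plane → ℝ}
    {A : Plane → Plane} (hA : IsVectorPotential Ω b A) {T : ℝ} {q p : ℝ → Plane}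
    (hqp : IsTrajectory A T q p) (hq : ∀ t ∈ Icc 0 T, q t ∈ Ω) {t : ℝ} (ht : t ∈ Icc 0 T) :
    (p t - A (q t)) 0 ^ 2 + (p t - A (q t)) 1 ^ 2 = 2 * hamiltonian A (q 0) (p 0) := by
  have h := norm_image_sub_le_of_norm_deriv_le_segment' (C := 0) (f' := fun _ => (0 : ℝ))
    (f := fun t => (p t - A (q t)) 0 ^ 2 + (p t - A (q t)) 1 ^ 2) (fun x hx => ?_)
    (fun _ _ => by simp) t ht
  · rw [zero_mul, norm_le_zero_iff, sub_eq_zero] at h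
    rw [h, hamiltonian, plane_norm_sq]
    ring
  · obtain ⟨-, h0, h1⟩ := hasDerivWithinAt_velocity hΩ hA hqp hx (hq x hx)
    refine ((h0.pow 2).add (h1.pow 2)).congr_deriv ?_
    ring

theorem abs_le_sqrt_of_frame {c d x y E : ℝ} (hcd : c ^ 2 + d ^ 2 = 1) (hE : x ^ 2 + y ^ 2 = E) :
    |x * c + y * d| ≤ √E ∧ |y * c - x * d| ≤ √E := by
  constructor <;> refine Real.abs_le_sqrt ?_
  · nlinarith [sq_nonneg (y * c - x * d)]
  · nlinarith [sq_nonneg (x * c + y * d)]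

section Coordinates

variable {Ω C : Set Plane} {γ : ℝ → Plane} {L δ ε T : ℝ} {b : Plane → ℝ} {A : Plane → Plane}
  {q p : ℝ → Plane} {n s : ℝ → ℝ}

/-- The sum of the angular momentum `s' (1 - n κ)²` and the flux `f(n)` varies at the rate
`-(B - B̄) n' - n κ' s'² (1 - n κ)`. -/
theorem hasDerivWithinAt_angularMomentum_add_flux (hΩ : IsOpen Ω) (hγ : IsArcLengthParam γ L C)
    (hκ : Differentiable ℝ (curvature γ)) (hb : ContinuousOn b Ω)
    (hA : IsVectorPotential Ω b A) (htub : IsTubular Ω C γ L δ)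
    (hint : ∀ n ∈ Ioo 0 δ, IntervalIntegrable
      (fun η => ∫ ξ in (0 : ℝ)..L, tubularField b γ η ξ) volume n δ)
    (hqp : IsTrajectory A T q p) (hq : ∀ t ∈ Icc 0 T, q t ∈ Ω)
    (hn : ∀ t ∈ Icc 0 T, n t ∈ Ioo 0 δ) (hs : ContinuousOn s (Icc 0 T))
    (hns : ∀ t ∈ Icc 0 T, q t = tube γ (n t) (s t))
    {t : ℝ} (ht : t ∈ Icc 0 T) (hr : 1 - n t * curvature γ (s t) ≠ 0) :
    HasDerivWithinAt
      (fun t => ((p t - A (q t)) 0 * deriv γ (s t) 0 + (p t - A (q t)) 1 * deriv γ (s t) 1) *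
        (1 - n t * curvature γ (s t)) + flux b γ L δ (n t))
      (-((tubularField b γ (n t) (s t) - 1 / L * ∫ ξ in (0 : ℝ)..L, tubularField b γ (n t) ξ) *
          ((p t - A (q t)) 1 * deriv γ (s t) 0 - (p t - A (q t)) 0 * deriv γ (s t) 1)) -
        n t * deriv (curvature γ) (s t) *
          ((p t - A (q t)) 0 * deriv γ (s t) 0 + (p t - A (q t)) 1 * deriv γ (s t) 1) ^ 2 /
          (1 - n t * curvature γ (s t)))
      (Icc 0 T) t := by
  obtain ⟨hq', h0, h1⟩ := hasDerivWithinAt_velocity hΩ hA hqp ht (hq t ht)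
  have hqc : ContinuousOn q (Icc 0 T) := fun x hx => (hqp x hx).1.continuousWithinAt
  obtain ⟨hn', hs'⟩ := hγ.hasDerivWithinAt_coordinates hs hns ht hq' hqc hr
  have hf := (hγ.hasDerivAt_flux htub hb (hn t ht) (hint _ (hn t ht))).comp_hasDerivWithinAt t hn'
  have hc := (hγ.hasDerivAt_deriv_zero (s t)).comp_hasDerivWithinAt t hs'
  have hd := (hγ.hasDerivAt_deriv_one (s t)).comp_hasDerivWithinAt t hs'
  have hk := (hκ (s t)).hasDerivAt.comp_hasDerivWithinAt t hs'
  refine ((((h0.mul hc).add (h1.mul hd)).mul ((hn'.mul hk).const_sub 1)).add hf).congr_deriv ?_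
  have hB : tubularField b γ (n t) (s t) = -b (q t) * (1 - n t * curvature γ (s t)) := by
    rw [tubularField, hns t ht]
  rw [hB]
  simp only [Pi.mul_apply, Pi.add_apply, Function.comp_apply]
  generalize (1 / L * ∫ ξ in (0 : ℝ)..L, tubularField b γ (n t) ξ) = β
  generalize (p t - A (q t)) 0 = x
  generalize (p t - A (q t)) 1 = y
  generalize 1 - n t * curvature γ (s t) = r at hr ⊢
  field_simp
  ring

/-- Along the trajectory, `|f(n(t))|` is bounded by the confinement constant, with `ε` replaced by
`|n κ|` in the contribution of the final velocity. -/
theorem abs_flux_le (hΩ : IsOpen Ω) (hγ : IsArcLengthParam γ L C)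
    (hκ : Differentiable ℝ (curvature γ))
    (hκ' : BddAbove (range fun s => |deriv (curvature γ) s|)) (hb : ContinuousOn b Ω)
    (hA : IsVectorPotential Ω b A) (hε : ε ∈ Ioo (0 : ℝ) 1) (hδ : 0 < δ)
    (hδε : δ ≤ ε / ⨆ s, |curvature γ s|) (htub : IsTubular Ω C γ L δ)
    (hint : ∀ n ∈ Ioo 0 δ, IntervalIntegrable
      (fun η => ∫ ξ in (0 : ℝ)..L, tubularField b γ η ξ) volume n δ)
    {M : ℝ} (hM : 0 ≤ M)
    (hBM : ∀ n ∈ Ioo 0 δ, ∀ s : ℝ,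
      |tubularField b γ n s - (1 / L) * ∫ ξ in (0 : ℝ)..L, tubularField b γ n ξ| ≤ M)
    (hT : 0 < T) (hqp : IsTrajectory A T q p) (hq : ∀ t ∈ Icc 0 T, q t ∈ Ω)
    (hn : ∀ t ∈ Icc 0 T, n t ∈ Ioo 0 δ) (hs : ContinuousOn s (Icc 0 T))
    (hns : ∀ t ∈ Icc 0 T, q t = tube γ (n t) (s t))
    {H₀ : ℝ} (hH₀ : hamiltonian A (q 0) (p 0) = H₀) {t : ℝ} (ht : t ∈ Icc 0 T) :
    |flux b γ L δ (n t)| ≤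
      |derivWithin s (Icc 0 T) 0 * (1 - curvature γ (s 0) * n 0) ^ 2
        - (1 / L) * ∫ η in n 0..δ, ∫ ξ in (0 : ℝ)..L, tubularField b γ η ξ|
      + √(2 * H₀) * (1 + |n t * curvature γ (s t)|)
      + (M * √(2 * H₀) + 2 * H₀ * (⨆ s, |deriv (curvature γ) s|) * δ / (1 - ε)) * T := by
  have hr : ∀ x ∈ Icc 0 T, 1 - ε < 1 - n x * curvature γ (s x) := fun x hx => by
    have := (abs_lt.1 (hγ.abs_mul_curvature_lt hδ hδε (hn x hx) (s x))).2
    linarith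
  have hε1 : 0 < 1 - ε := sub_pos.2 hε.2
  have hr0 : ∀ x ∈ Icc 0 T, 0 < 1 - n x * curvature γ (s x) := fun x hx => hε1.trans (hr x hx)
  have hE : ∀ x ∈ Icc 0 T, _ := fun x hx => energy_conservation hΩ hA hqp hq hx
  rw [hH₀] at hE
  have hH : 0 ≤ 2 * H₀ := by
    rw [← hE t ht]
    positivity
  have hbound : ∀ x ∈ Icc 0 T, _ := fun x hx =>
    abs_le_sqrt_of_frame (hγ.deriv_sq (s x)) (hE x hx)
  have hmv := norm_image_sub_le_of_norm_deriv_le_segment'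
    (C := M * √(2 * H₀) + 2 * H₀ * (⨆ s, |deriv (curvature γ) s|) * δ / (1 - ε))
    (fun x hx => hasDerivWithinAt_angularMomentum_add_flux hΩ hγ hκ hb hA htub hint hqp hq hn hs
      hns hx (hr0 x hx).ne') (fun x hx => ?_) t ht
  · have h0 : (0 : ℝ) ∈ Icc 0 T := ⟨le_rfl, hT.le⟩
    have hqc : ContinuousOn q (Icc 0 T) := fun x hx => (hqp x hx).1.continuousWithinAt
    have hs0 := ((hγ.hasDerivWithinAt_coordinates hs hns h0
      (hasDerivWithinAt_velocity hΩ hA hqp h0 (hq 0 h0)).1 hqc (hr0 0 h0).ne').2).derivWithin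
      (uniqueDiffOn_Icc hT 0 h0)
    have hu0 : ((p 0 - A (q 0)) 0 * deriv γ (s 0) 0 + (p 0 - A (q 0)) 1 * deriv γ (s 0) 1) *
        (1 - n 0 * curvature γ (s 0)) + flux b γ L δ (n 0) =
        derivWithin s (Icc 0 T) 0 * (1 - curvature γ (s 0) * n 0) ^ 2
        - (1 / L) * ∫ η in n 0..δ, ∫ ξ in (0 : ℝ)..L, tubularField b γ η ξ := by
      rw [hs0, flux, mul_comm (curvature γ (s 0))]
      have := (hr0 0 h0).ne'
      generalize 1 - n 0 * curvature γ (s 0) = r at this ⊢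
      field_simp
      ring
    rw [hu0, Real.norm_eq_abs, sub_zero] at hmv
    have hP : |((p t - A (q t)) 0 * deriv γ (s t) 0 + (p t - A (q t)) 1 * deriv γ (s t) 1) *
        (1 - n t * curvature γ (s t))| ≤ √(2 * H₀) * (1 + |n t * curvature γ (s t)|) := by
      rw [abs_mul]
      refine mul_le_mul (hbound t ht).1 ?_ (abs_nonneg _) (Real.sqrt_nonneg _)
      exact (abs_sub _ _).trans_eq (by rw [abs_one])
    have hK' : 0 ≤ ⨆ s, |deriv (curvature γ) s| := Real.iSup_nonneg fun _ => abs_nonneg _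
    have hC : 0 ≤ M * √(2 * H₀) + 2 * H₀ * (⨆ s, |deriv (curvature γ) s|) * δ / (1 - ε) := by
      positivity
    have hCt := mul_le_mul_of_nonneg_left ht.2 hC
    generalize derivWithin s (Icc 0 T) 0 * (1 - curvature γ (s 0) * n 0) ^ 2
        - (1 / L) * ∫ η in n 0..δ, ∫ ξ in (0 : ℝ)..L, tubularField b γ η ξ = G at hmv ⊢
    obtain ⟨hmv₁, hmv₂⟩ := abs_le.1 hmv
    obtain ⟨hP₁, hP₂⟩ := abs_le.1 hP
    have hG₁ := le_abs_self G
    have hG₂ := neg_abs_le G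
    exact abs_le.2 ⟨by linarith, by linarith⟩
  · have hx' := Ico_subset_Icc_self hx
    have hu := sq_abs ((p x - A (q x)) 0 * deriv γ (s x) 0 + (p x - A (q x)) 1 * deriv γ (s x) 1)
    have hu2 := pow_le_pow_left₀ (abs_nonneg _) (hbound x hx').1 2
    rw [hu, Real.sq_sqrt hH] at hu2
    have hκx : |deriv (curvature γ) (s x)| ≤ ⨆ s, |deriv (curvature γ) s| := le_ciSup hκ' (s x)
    have hnx := hn x hx'
    rw [Real.norm_eq_abs]
    refine (abs_sub _ _).trans (add_le_add ?_ ?_)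
    · rw [abs_neg, abs_mul]
      exact mul_le_mul (hBM _ hnx _) (hbound x hx').2 (abs_nonneg _) hM
    · rw [abs_div, abs_of_pos (hr0 x hx'), abs_mul, abs_mul, abs_of_pos hnx.1, abs_sq]
      refine div_le_div₀ ?_ ?_ hε1 (hr x hx').le
      · have := (abs_nonneg _).trans hκx
        positivity
      · calc n x * |deriv (curvature γ) (s x)| * _ ≤
            δ * (⨆ s, |deriv (curvature γ) s|) * (2 * H₀) := by
              refine mul_le_mul (mul_le_mul hnx.2.le hκx (abs_nonneg _) hδ.le) hu2
                (sq_nonneg _) (mul_nonneg hδ.le ((abs_nonneg _).trans hκx))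
          _ = _ := by ring

end Coordinates

theorem confinementConst_nonneg (b : Plane → ℝ) (γ : ℝ → Plane) {L δ ε M H₀ n₀ s₀ v₀ T : ℝ}
    (hδ : 0 ≤ δ) (hε : ε ∈ Ioo (0 : ℝ) 1) (hM : 0 ≤ M) (hH₀ : 0 ≤ H₀) (hT : 0 ≤ T) :
    0 ≤ confinementConst b γ L δ ε M H₀ n₀ s₀ v₀ T := by
  have hK' : 0 ≤ ⨆ s, |deriv (curvature γ) s| := Real.iSup_nonneg fun _ => abs_nonneg _
  have hε0 := hε.1
  have hε1 : 0 < 1 - ε := sub_pos.2 hε.2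
  unfold confinementConst
  positivity

theorem theorem2p2
    -- the domain, one boundary component and its arc length parametrization
    (Ω : Set Plane) (hΩ : IsOpen Ω)
    (C : Set Plane) (hC : IsBoundaryComponent Ω C)
    (γ : ℝ → Plane) (L : ℝ) (hγ : IsArcLengthParam γ L C)
    (hκ : Differentiable ℝ (curvature γ))
    (hκ' : BddAbove (range fun s => |deriv (curvature γ) s|))
    -- the magnetic field and a vector potential
    (b : Plane → ℝ) (hb : LocallyLipschitzOn Ω b)
    (A : Plane → Plane) (hA : IsVectorPotential Ω b A)
    -- the collar
    (ε : ℝ) (hε : ε ∈ Ioo (0 : ℝ) 1)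
    (δ : ℝ) (hδ : 0 < δ) (hδε : δ ≤ ε / ⨆ s, |curvature γ s|)
    (htub : IsTubular Ω C γ L δ)
    -- the integrals defining `f` converge
    (hint : ∀ n ∈ Ioo 0 δ, IntervalIntegrable
      (fun η => ∫ ξ in (0 : ℝ)..L, tubularField b γ η ξ) volume n δ)
    (M : ℝ) (hM : 0 ≤ M)
    (hBM : ∀ n ∈ Ioo 0 δ, ∀ s : ℝ,
      |tubularField b γ n s - (1 / L) * ∫ ξ in (0 : ℝ)..L, tubularField b γ n ξ| ≤ M)
    -- a trajectory in the collar, with its tubular coordinates (`s` is a continuous lift to `ℝ`)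
    (T : ℝ) (hT : 0 < T)
    (q p : ℝ → Plane) (hqp : IsTrajectory A T q p)
    (hq : ∀ t ∈ Icc 0 T, q t ∈ collar Ω C δ)
    (n s : ℝ → ℝ) (hn : ∀ t ∈ Icc 0 T, n t ∈ Ioo 0 δ) (hs : ContinuousOn s (Icc 0 T))
    (hns : ∀ t ∈ Icc 0 T, q t = tube γ (n t) (s t))
    (H₀ : ℝ) (hH₀ : hamiltonian A (q 0) (p 0) = H₀)
    (CT : ℝ) (hCT : CT = confinementConst b γ L δ ε M H₀ (n 0) (s 0)
      (derivWithin s (Icc 0 T) 0) T)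
    (hlim : (CT : EReal) < liminfFlux b γ L δ) :
    (∃ g : ℝ → ℝ, IsMinorant b γ L δ g) ∧
    ∀ g : ℝ → ℝ, IsMinorant b γ L δ g →
      ∃ m ∈ Ioc 0 δ, g m = CT ∧
        ∀ t ∈ Ico 0 T, m ≤ n t ∧ (0 < H₀ → m < n t) := by
  have hbc := hb.continuousOn
  have hH : 0 ≤ H₀ := by
    rw [← hH₀, hamiltonian]
    positivity
  have hCT0 : 0 ≤ CT := hCT ▸ confinementConst_nonneg b γ hδ.le hε hM hH hT.le
  refine ⟨exists_isMinorant b γ L δ, fun g hg => ?_⟩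
  obtain ⟨m, hm, hgm⟩ := hg.exists_eq hδ hCT0 hlim
  refine ⟨m, hm, hgm, fun t ht => ?_⟩
  have ht' := Ico_subset_Icc_self ht
  have hnt : n t ∈ Ioc 0 δ := Ioo_subset_Ioc_self (hn t ht')
  have hflux := abs_flux_le hΩ hγ hκ hκ' hbc hA hε hδ hδε htub hint hM hBM hT hqp
    (fun x hx => (hq x hx).1) hn hs hns hH₀ ht'
  have hnκ := hγ.abs_mul_curvature_lt hδ hδε (hn t ht') (s t)
  have hgn := hg.le_abs (n t) hnt
  unfold confinementConst at hCT
  constructor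
  · refine (hg.strictAntiOn.le_iff_ge hnt hm).1 ?_
    have := mul_le_mul_of_nonneg_left (add_le_add_right hnκ.le 1) (Real.sqrt_nonneg (2 * H₀))
    linarith
  · intro hpos
    refine (hg.strictAntiOn.lt_iff_gt hnt hm).1 ?_
    have := mul_lt_mul_of_pos_left (add_lt_add_right hnκ 1)
      (Real.sqrt_pos.2 (show 0 < 2 * H₀ by linarith))
    linarith
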